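/- **Setting.** An *abstract state space* $(A,\Omega_A,u_A)$ consists of a finite-dimensional real vector space $A$, a convex compact set $\Omega_A\subset A$ (the normalized states) such that $A_+:=\mathbb R_{\ge 0}\cdot\Omega_A$ is a closed, pointed, generating convex cone, and a linear functional $u_A$ on $A$ which is strictly positive on $A_+\setminus\{0\}$ and satisfies, for $w\in A_+$, $u_A(w)=1\iff w\in\Omega_A$. An *effect* is a linear functional $e$ with $0\le e\le u_A$ on $A_+$. In addition there are given a set $\mathcal E_A$ of *allowed* effects, such that $e\in\mathcal E_A\Rightarrow u_A-e\in\mathcal E_A$ and such that $e,f\in\mathcal E_A$, $e+f\le u_A$ on $A_+$ imply $e+f\in\mathcal E_A$, and a group $\mathcal G_A$ of *reversible transformations*, i.e. of invertible linear maps $T:A\to A$ with $T(A_+)\subset A_+$ and $u_A\circ T\le u_A$ on $A_+$, such that $e\circ T\in\mathcal E_A$ for all $e\in\mathcal E_A$, $T\in\mathcal G_A$. *Pure* states are the extreme points of $\Omega_A$; the other states are *mixed*. States $w_1,\dots,w_n\in\Omega_A$ are *perfectly distinguishable* if there are $e_1,\dots,e_n\in\mathcal E_A$ with $\sum_j e_j\le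 u_A$ on $A_+$ and $e_j(w_k)=\delta_{jk}$. An ($n$-)*frame* is a family of $n$ perfectly distinguishable pure states; a frame is *maximal* if no frame has more members. A *classical decomposition* of $w\in\Omega_A$ is a representation $w=\sum_j p_jw_j$ with $(p_j)$ a probability vector and $(w_j)$ a frame. *Postulate 1 (classical decomposability).* Every $w\in\Omega_A$ has a classical decomposition. *Postulate 2 (strong symmetry).* For every $n\in\mathbb N$ and all $n$-frames $w_1,\dots,w_n$ and $v_1,\dots,v_n$ there is $T\in\mathcal G_A$ with $T(w_j)=v_j$ for all $j$. The *entropy* of $w\in\Omega_A$ is $S(w):=-\sum_j p_j\ln p_j$ for a classical decomposition $w=\sum_jp_jw_j$ (with $0\ln 0=0$). Call an inner product $\langle\cdot,\cdot\rangle$ on $A$ *self-dualizing* if * a linear functional on $A$ is nonnegative on $A_+$ if and only if it is of the form $\langle\cdot,w\rangle$ with $w\in A_+$, * $\langle Tw,Tv\rangle=\langle w,v\rangle$ for all $T\in\mathcal G_A$ and $w,v\in A$, * $0\le\langle w,v\rangle\le1$ for all $w,v\in\Omega_A$, * $\langle w,w\rangle=1$ for pure $w$ and $\langle v,v\rangle<1$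 for mixed $v\in\Omega_A$, * $\langle w,v\rangle=0$ for perfectly distinguishable $w,v\in\Omega_A$. For such an inner product, $w\in\Omega_A$, and a classical decomposition $v=\sum_kq_kv_k$ of $v\in\Omega_A$ into a maximal frame, the *relative entropy* is $$S(w\|v):=-S(w)-\langle w,\ln v\rangle\in(-\infty,+\infty],\qquad \langle w,\ln v\rangle:=\sum_k\langle w,v_k\rangle\ln q_k,$$ with the conventions $\ln 0=-\infty$ and $0\cdot(-\infty)=0$. **Theorem.** Assume Postulates 1 and 2. 1. The entropy $S(w)$ of every $w\in\Omega_A$ is well-defined: it is the same for all classical decompositions of $w$. Every $v\in\Omega_A$ has a classical decomposition into a maximal frame, and a self-dualizing inner product exists. 2. (Klein's inequality) For every self-dualizing inner product, all $w,v\in\Omega_A$, and every classical decomposition of $v$ into a maximal frame, $S(w\|v)\ge0$. 3. (Concavity of the entropy) For all $w_1,\dots,w_n\in\Omega_A$ and every probability vector $(p_1,\dots,p_n)$, $$S\Big(\sum_j p_jw_j\Big)\ \ge\ \sum_j p_jS(w_j).$$ -/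

import Mathlib

open scoped BigOperators

/-- A (pointed convex) cone in a real vector space. -/
structure IsCone {V : Type*} [AddCommGroup V] [Module ℝ V] (K : Set V) : Prop where
  nonempty : K.Nonempty
  add_mem : ∀ x ∈ K, ∀ y ∈ K, x + y ∈ K
  smul_mem : ∀ r : ℝ, 0 ≤ r → ∀ x ∈ K, r • x ∈ K
  pointed : ∀ x ∈ K, -x ∈ K → x = 0

/-- The set `ℝ_{≥ 0} · Ω`. -/
def rayHull {V : Type*} [AddCommGroup V] [Module ℝ V] (Ω : Set V) : Set V :=
  {x | ∃ r : ℝ, 0 ≤ r ∧ ∃ w ∈ Ω, x = r • w}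

/-- An abstract state space `(A, Ω_A, u_A)`. The norm of `A` only serves to provide the usual
topology of a finite-dimensional real vector space. -/
structure AbstractStateSpace (A : Type*) [NormedAddCommGroup A] [NormedSpace ℝ A]
    [FiniteDimensional ℝ A] where
  /-- the set `Ω_A` of normalized states -/
  states : Set A
  /-- the order unit `u_A` -/
  unit : Module.Dual ℝ A
  convex_states : Convex ℝ states
  isCompact_states : IsCompact states
  isCone : IsCone (rayHull states)
  isClosed_cone : IsClosed (rayHull states)
  /-- the cone is generating -/
  generating : ∀ x : A, ∃ y ∈ rayHull states, ∃ z ∈ rayHull states, x = y - z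
  unit_pos : ∀ x ∈ rayHull states, x ≠ 0 → 0 < unit x
  unit_eq_one_iff : ∀ x ∈ rayHull states, unit x = 1 ↔ x ∈ states

namespace AbstractStateSpace

variable {A : Type*} [NormedAddCommGroup A] [NormedSpace ℝ A] [FiniteDimensional ℝ A]

/-- The cone `A_+` of unnormalized states. -/
def cone (S : AbstractStateSpace A) : Set A := rayHull S.states

/-- Effects: linear functionals `e` with `0 ≤ e ≤ u_A` on `A_+`. -/
def IsEffect (S : AbstractStateSpace A) (e : Module.Dual ℝ A) : Prop :=
  ∀ x ∈ S.cone, 0 ≤ e x ∧ e x ≤ S.unit x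

/-- Transformations of `A` into itself: linear, positive, not increasing the normalization. -/
def IsTransformation (S : AbstractStateSpace A) (T : A →ₗ[ℝ] A) : Prop :=
  (∀ x ∈ S.cone, T x ∈ S.cone) ∧ ∀ x ∈ S.cone, S.unit (T x) ≤ S.unit x

/-- The dual cone `A_+^*`. -/
def dualCone (S : AbstractStateSpace A) : Set (Module.Dual ℝ A) :=
  {e | ∀ x ∈ S.cone, 0 ≤ e x}

end AbstractStateSpace

/-- A dynamical abstract state space (GPT): an abstract state space together with the set of its
physically allowed effects and the group `𝒢_A` of its physically allowed reversible
transformations. No hypothesis is made that all effects, or all invertible transformations,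
are allowed. -/
structure GPT (A : Type*) [NormedAddCommGroup A] [NormedSpace ℝ A] [FiniteDimensional ℝ A]
    extends AbstractStateSpace A where
  /-- the set of allowed effects -/
  allowed : Set (Module.Dual ℝ A)
  isEffect_of_allowed : ∀ e ∈ allowed, toAbstractStateSpace.IsEffect e
  /-- the counter-event of an allowed effect is allowed -/
  compl_allowed : ∀ e ∈ allowed, unit - e ∈ allowed
  /-- coarse-graining: sums of allowed effects are allowed as long as they are effects -/
  add_allowed : ∀ e ∈ allowed, ∀ f ∈ allowed,
    (∀ x ∈ toAbstractStateSpace.cone, (e + f) x ≤ unit x) → e + f ∈ allowed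
  /-- the group `𝒢_A` of allowed reversible transformations; since it is closed under inverses,
  the inverse of a member is a transformation as well -/
  reversible : Subgroup (A ≃ₗ[ℝ] A)
  isTransformation_of_reversible : ∀ T ∈ reversible,
    toAbstractStateSpace.IsTransformation (T : A →ₗ[ℝ] A)
  /-- an allowed effect after an allowed reversible transformation is an allowed effect -/
  comp_allowed : ∀ e ∈ allowed, ∀ T ∈ reversible, e ∘ₗ (T : A →ₗ[ℝ] A) ∈ allowed

namespace GPT

variable {A : Type*} [NormedAddCommGroup A] [NormedSpace ℝ A] [FiniteDimensional ℝ A]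

/-- Pure states: the extreme points of the set of normalized states. -/
def pureStates (G : GPT A) : Set A := G.states.extremePoints ℝ

/-- The states `w 0, …, w (n - 1)` are perfectly distinguishable: there are allowed effects `e j`
with `∑ j, e j ≤ u_A` and `e j (w k) = δ_{jk}`. -/
def PerfectlyDistinguishable (G : GPT A) {n : ℕ} (w : Fin n → A) : Prop :=
  (∀ j, w j ∈ G.states) ∧
  ∃ e : Fin n → Module.Dual ℝ A, (∀ j, e j ∈ G.allowed) ∧
    (∀ x ∈ G.cone, ∑ j, e j x ≤ G.unit x) ∧
    ∀ j k, e j (w k) = if j = k then 1 else 0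

/-- An `n`-frame: `n` perfectly distinguishable pure states. -/
def IsFrame (G : GPT A) {n : ℕ} (w : Fin n → A) : Prop :=
  G.PerfectlyDistinguishable w ∧ ∀ j, w j ∈ G.pureStates

/-- A maximal frame: a frame of maximal size. -/
def IsMaximalFrame (G : GPT A) {n : ℕ} (w : Fin n → A) : Prop :=
  G.IsFrame w ∧ ∀ (m : ℕ) (v : Fin m → A), G.IsFrame v → m ≤ n

/-- `w = ∑ j, p j • v j` is a classical decomposition of `w`: the `p j` form a probability
distribution and the `v j` are perfectly distinguishable pure states. -/
def IsClassicalDecomposition (G : GPT A) (w : A) {n : ℕ} (p : Fin n → ℝ) (v : Fin n → A) : Prop :=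
  p ∈ stdSimplex ℝ (Fin n) ∧ G.IsFrame v ∧ w = ∑ j, p j • v j

/-- Postulate 1 (classical decomposability). -/
def ClassicalDecomposability (G : GPT A) : Prop :=
  ∀ w ∈ G.states, ∃ (n : ℕ) (p : Fin n → ℝ) (v : Fin n → A), G.IsClassicalDecomposition w p v

/-- Postulate 2 (strong symmetry). -/
def StrongSymmetry (G : GPT A) : Prop :=
  ∀ (n : ℕ) (w v : Fin n → A), G.IsFrame w → G.IsFrame v →
    ∃ T ∈ G.reversible, ∀ j, T (w j) = v j

/-- The Shannon entropy `- ∑ j, p j * ln (p j)`, with `0 * ln 0 = 0`. -/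
noncomputable def shannon {n : ℕ} (p : Fin n → ℝ) : ℝ := ∑ j, Real.negMulLog (p j)

/-- The entropy `S(w) = - ∑ j, p j * ln (p j)` of a state `w`, for a classical decomposition
`w = ∑ j, p j • v j` of `w` (any one, picked by choice). -/
noncomputable def entropy (G : GPT A) (w : A) : ℝ :=
  Classical.epsilon fun s : ℝ => ∃ (n : ℕ) (p : Fin n → ℝ) (v : Fin n → A),
    G.IsClassicalDecomposition w p v ∧ s = shannon p

/-- A self-dualizing inner product on `A` that is adapted to the states, the pure states, the
perfectly distinguishable states and the reversible transformations. -/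
structure IsSelfDualizing (G : GPT A) (B : LinearMap.BilinForm ℝ A) : Prop where
  symm : ∀ x y, B x y = B y x
  pos : ∀ x, x ≠ 0 → 0 < B x x
  self_dual : G.dualCone = {e | ∃ w ∈ G.cone, ∀ x, e x = B x w}
  invariant : ∀ T ∈ G.reversible, ∀ x y, B (T x) (T y) = B x y
  mem_unitInterval : ∀ w ∈ G.states, ∀ v ∈ G.states, 0 ≤ B w v ∧ B w v ≤ 1
  pure : ∀ w ∈ G.pureStates, B w w = 1
  mixed : ∀ v ∈ G.states, v ∉ G.pureStates → B v v < 1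
  orthogonal : ∀ w v, G.PerfectlyDistinguishable ![w, v] → B w v = 0

/-- The relative entropy `S(w‖v) = - S(w) - ⟨w, ln v⟩` for a decomposition `v = ∑ k, q k • f k`
into a maximal frame `f`, where `⟨w, ln v⟩ = ∑ k, ⟨w, f k⟩ * ln (q k)`. Its values are extended
reals, with `ln 0 = -∞` and `0 * (-∞) = 0`. -/
noncomputable def relEntropy (G : GPT A) (B : LinearMap.BilinForm ℝ A) (w : A) {n : ℕ}
    (q : Fin n → ℝ) (f : Fin n → A) : EReal :=
  -(G.entropy w : EReal) - ∑ k, (B w (f k) : EReal) * ENNReal.log (ENNReal.ofReal (q k))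

/-- If all coefficients `q k` are positive, the relative entropy is the real number
`- S(w) - ⟨w, ln v⟩` with the vector `ln v = ∑ k, ln (q k) • f k`. -/
theorem relEntropy_of_pos (G : GPT A) (B : LinearMap.BilinForm ℝ A) (w : A) {n : ℕ}
    (q : Fin n → ℝ) (f : Fin n → A) (hq : ∀ k, 0 < q k) :
    G.relEntropy B w q f =
      ((-G.entropy w - B w (∑ k, Real.log (q k) • f k) : ℝ) : EReal) := by
  have h : ∀ k, (B w (f k) : EReal) * ENNReal.log (ENNReal.ofReal (q k)) =
      ((Real.log (q k) * B w (f k) : ℝ) : EReal) := by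
    intro k
    rw [ENNReal.log_ofReal_of_pos (hq k), ← EReal.coe_mul, mul_comm]
  have hs : ∀ s : Finset (Fin n),
      ∑ k ∈ s, (B w (f k) : EReal) * ENNReal.log (ENNReal.ofReal (q k)) =
        ((∑ k ∈ s, Real.log (q k) * B w (f k) : ℝ) : EReal) := by
    intro s
    induction s using Finset.induction_on with
    | empty => simp
    | insert a s ha ih => rw [Finset.sum_insert ha, Finset.sum_insert ha, ih, h, EReal.coe_add]
  simp only [relEntropy, hs, map_sum, map_smul, smul_eq_mul]
  rfl

end GPT

/-! The postulates force a spectral theory, and the entropy statements follow from it by Jensen's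
inequality. The reversible transformations are uniformly bounded, so a fixed-point argument gives an
invariant state and an invariant inner product. Strong symmetry realizes every permutation of a
frame; hence the invariant state has equal weights on a maximal frame, and all maximal frames have
the same sum (`IsMaximalFrame.sum_eq`). Adding a multiple of this sum moves any vector into the
cone, which yields `exists_spectral_decomposition`.

By symmetry the invariant inner product takes one value on all pure states and one on all 2-frames.
Subtracting a multiple of `u ⊗ u` and rescaling makes every frame orthonormal; spectral
decompositions then give positivity and self-duality.

For two maximal frames `g`, `f` the matrix `B (g j) (f k)` is doubly stochastic. Concavity of `-t ln
t` therefore shows that the coefficients of a classical decomposition have the least Shannon entropy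
among transition probabilities to maximal frames (`IsSelfDualizing.shannon_le`). Used in both
directions this makes the entropy well-defined; with Gibbs' inequality it gives Klein's inequality,
and with Jensen once more it gives concavity. -/

/-! ### Fixed points of bounded linear group actions -/

/-- A uniformly bounded linear group action on a finite-dimensional space has a fixed point in
every nonempty closed convex invariant set. -/
theorem exists_fixedPoint_of_uniformlyBounded {V H : Type*} [NormedAddCommGroup V]
    [NormedSpace ℝ V] [FiniteDimensional ℝ V] [Group H] (ρ : H → V →L[ℝ] V)
    (one : ∀ x, ρ 1 x = x) (mul : ∀ g h x, ρ (g * h) x = ρ g (ρ h x)) {C : ℝ}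
    (hC : ∀ h x, ‖ρ h x‖ ≤ C * ‖x‖) {K : Set V} (hcl : IsClosed K) (hconv : Convex ℝ K)
    (hne : K.Nonempty) (hinv : ∀ h, ∀ x ∈ K, ρ h x ∈ K) : ∃ x ∈ K, ∀ h, ρ h x = x := by
  obtain ⟨x₀, hx₀⟩ := hne
  let e := toEuclidean (E := V)
  obtain ⟨M, hM0, hM⟩ : ∃ M : ℝ, 0 ≤ M ∧ ∀ h x, ‖e (ρ h x)‖ ≤ M * ‖x‖ := by
    refine ⟨‖e.toContinuousLinearMap‖ * |C|, by positivity, fun h x => ?_⟩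
    calc ‖e (ρ h x)‖ ≤ ‖e.toContinuousLinearMap‖ * ‖ρ h x‖ := e.toContinuousLinearMap.le_opNorm _
      _ ≤ ‖e.toContinuousLinearMap‖ * (|C| * ‖x‖) := by
        gcongr
        exact (hC h x).trans (by gcongr; exact le_abs_self C)
      _ = _ := by ring
  obtain ⟨L, hL0, hL⟩ : ∃ L : ℝ, 0 < L ∧ ∀ h x, ‖x‖ ≤ L * ‖e (ρ h x)‖ := by
    refine ⟨|C| * ‖e.symm.toContinuousLinearMap‖ + 1, by positivity, fun h x => ?_⟩
    have h1 : ρ h⁻¹ (ρ h x) = x := by rw [← mul, inv_mul_cancel, one]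
    calc ‖x‖ = ‖ρ h⁻¹ (ρ h x)‖ := by rw [h1]
      _ ≤ |C| * ‖ρ h x‖ := (hC _ _).trans (by gcongr; exact le_abs_self C)
      _ = |C| * ‖e.symm (e (ρ h x))‖ := by rw [e.symm_apply_apply]
      _ ≤ |C| * (‖e.symm.toContinuousLinearMap‖ * ‖e (ρ h x)‖) := by
        gcongr
        exact e.symm.toContinuousLinearMap.le_opNorm _
      _ ≤ _ := by nlinarith [norm_nonneg (e (ρ h x))]
  -- The largest Euclidean norm along the orbit. Its minimizer on `K` turns out to be fixed.
  let N : V → ℝ := fun x => ⨆ h, ‖e (ρ h x)‖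
  have hbdd : ∀ x, BddAbove (Set.range fun h => ‖e (ρ h x)‖) := fun x =>
    ⟨M * ‖x‖, by rintro _ ⟨h, rfl⟩; exact hM h x⟩
  have hle : ∀ x h, ‖e (ρ h x)‖ ≤ N x := fun x h => le_ciSup (hbdd x) h
  have hN0 : ∀ x, 0 ≤ N x := fun x => (norm_nonneg _).trans (hle x 1)
  have hlip : LipschitzWith ⟨M, hM0⟩ N := by
    refine LipschitzWith.of_le_add_mul _ fun x y => ciSup_le fun h => ?_
    have h1 : e (ρ h x) = e (ρ h y) + e (ρ h (x - y)) := by simp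
    rw [h1]
    refine (norm_add_le _ _).trans (add_le_add (hle y h) ?_)
    rw [dist_eq_norm]
    exact hM h _
  have hcomp : IsCompact (K ∩ {x | N x ≤ N x₀}) := by
    refine Metric.isCompact_of_isClosed_isBounded
      (hcl.inter (isClosed_le hlip.continuous continuous_const)) ?_
    refine isBounded_iff_forall_norm_le.2 ⟨L * N x₀, fun x hx => ?_⟩
    exact (hL 1 x).trans (by gcongr; exact (hle x 1).trans hx.2)
  obtain ⟨x, ⟨hxK, hx0⟩, hmin⟩ := hcomp.exists_isMinOn ⟨x₀, hx₀, le_refl (N x₀)⟩ hlip.continuous.continuousOn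
  have hmin' : ∀ y ∈ K, N x ≤ N y := by
    intro y hy
    by_cases h : N y ≤ N x₀
    · exact hmin ⟨hy, h⟩
    · exact hx0.trans (not_le.1 h).le
  refine ⟨x, hxK, fun g => ?_⟩
  set y := ρ g x with hy
  have hNy : ∀ h, ‖e (ρ h y)‖ ≤ N x := fun h => by rw [hy, ← mul]; exact hle _ _
  have hz : (1 / 2 : ℝ) • x + (1 / 2 : ℝ) • y ∈ K :=
    hconv hxK (hinv g x hxK) (by norm_num) (by norm_num) (by norm_num)
  -- By the parallelogram law the midpoint of `x` and `ρ g x` beats the minimum by a gap uniform in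
  -- `h`, unless the two points coincide.
  have key : ∀ h, ‖e (ρ h ((1 / 2 : ℝ) • x + (1 / 2 : ℝ) • y))‖ ^ 2 ≤
      N x ^ 2 - (‖x - y‖ / L) ^ 2 / 4 := by
    intro h
    have hp := parallelogram_law_with_norm ℝ (e (ρ h x)) (e (ρ h y))
    have h1 : e (ρ h ((1 / 2 : ℝ) • x + (1 / 2 : ℝ) • y)) =
        (1 / 2 : ℝ) • (e (ρ h x) + e (ρ h y)) := by simp
    have h2 : e (ρ h x) - e (ρ h y) = e (ρ h (x - y)) := by simp
    rw [h2] at hp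
    have h3 : ‖x - y‖ / L ≤ ‖e (ρ h (x - y))‖ := by
      rw [div_le_iff₀ hL0, mul_comm]; exact hL h _
    rw [h1, norm_smul]
    have h4 := hle x h
    have h5 := hNy h
    have h6 : (‖x - y‖ / L) ^ 2 ≤ ‖e (ρ h (x - y))‖ ^ 2 := by gcongr
    have h7 : ‖e (ρ h x)‖ ^ 2 ≤ N x ^ 2 := by gcongr
    have h8 : ‖e (ρ h y)‖ ^ 2 ≤ N x ^ 2 := by gcongr
    norm_num
    nlinarith
  have hN2 : N ((1 / 2 : ℝ) • x + (1 / 2 : ℝ) • y) ≤ √(N x ^ 2 - (‖x - y‖ / L) ^ 2 / 4) :=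
    ciSup_le fun h => Real.le_sqrt_of_sq_le (key h)
  have h9 : N x ^ 2 ≤ N x ^ 2 - (‖x - y‖ / L) ^ 2 / 4 :=
    (Real.le_sqrt (hN0 x) ((sq_nonneg _).trans (key 1))).1 ((hmin' _ hz).trans hN2)
  have h10 : ‖x - y‖ / L = 0 := by nlinarith [sq_nonneg (‖x - y‖ / L)]
  have h11 : ‖x - y‖ = 0 := by
    rcases div_eq_zero_iff.1 h10 with h | h
    · exact h
    · exact absurd h hL0.ne'
  exact (sub_eq_zero.1 (norm_eq_zero.1 h11)).symm

/-- The action of linear maps on bilinear forms by pullback along the argument. -/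
noncomputable def pullbackForm {V : Type*} [NormedAddCommGroup V] [NormedSpace ℝ V]
    (P : V →L[ℝ] V) :
    (V →L[ℝ] V →L[ℝ] ℝ) →L[ℝ] (V →L[ℝ] V →L[ℝ] ℝ) :=
  (ContinuousLinearMap.precomp ℝ P).postcomp V ∘L P.precomp (V →L[ℝ] ℝ)

@[simp]
theorem pullbackForm_apply {V : Type*} [NormedAddCommGroup V] [NormedSpace ℝ V]
    (P : V →L[ℝ] V) (b : V →L[ℝ] V →L[ℝ] ℝ) (x y : V) :
    pullbackForm P b x y = b (P x) (P y) := rfl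

/-! ### States and the cone -/

namespace AbstractStateSpace

variable {A : Type*} [NormedAddCommGroup A] [NormedSpace ℝ A] [FiniteDimensional ℝ A]
  (S : AbstractStateSpace A)

theorem states_nonempty : S.states.Nonempty := by
  obtain ⟨_, r, _, w, hw, _⟩ := S.isCone.nonempty
  exact ⟨w, hw⟩

theorem mem_cone_of_mem_states {w : A} (hw : w ∈ S.states) : w ∈ S.cone :=
  ⟨1, zero_le_one, w, hw, (one_smul ℝ w).symm⟩

theorem unit_of_mem_states {w : A} (hw : w ∈ S.states) : S.unit w = 1 :=
  (S.unit_eq_one_iff w (S.mem_cone_of_mem_states hw)).2 hw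

theorem sum_mem_cone {ι : Type*} (s : Finset ι) (x : ι → A) (hx : ∀ i ∈ s, x i ∈ S.cone) :
    ∑ i ∈ s, x i ∈ S.cone := by
  classical
  induction s using Finset.induction_on with
  | empty =>
    obtain ⟨x, hx⟩ := S.isCone.nonempty
    rw [Finset.sum_empty, ← zero_smul ℝ x]
    exact S.isCone.smul_mem 0 le_rfl x hx
  | insert a s ha ih =>
    rw [Finset.sum_insert ha]
    exact S.isCone.add_mem _ (hx _ (Finset.mem_insert_self _ _)) _
      (ih fun i hi => hx i (Finset.mem_insert_of_mem hi))

/-- Two linear maps that agree on the states agree. -/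
theorem linearMap_ext {F : Type*} [AddCommGroup F] [Module ℝ F] {f g : A →ₗ[ℝ] F}
    (h : ∀ w ∈ S.states, f w = g w) : f = g := by
  ext x
  obtain ⟨_, ⟨r, _, w, hw, rfl⟩, _, ⟨s, _, v, hv, rfl⟩, rfl⟩ := S.generating x
  simp [h w hw, h v hv]

end AbstractStateSpace

namespace GPT

variable {A : Type*} [NormedAddCommGroup A] [NormedSpace ℝ A] [FiniteDimensional ℝ A]
  {G : GPT A}

/-! ### Reversible transformations and their invariants -/

section Reversible

variable {T : A ≃ₗ[ℝ] A}

theorem map_mem_cone (hT : T ∈ G.reversible) {x : A} (hx : x ∈ G.cone) : T x ∈ G.cone :=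
  (G.isTransformation_of_reversible T hT).1 x hx

/-- Reversible transformations preserve the normalization. -/
theorem unit_map (hT : T ∈ G.reversible) (x : A) : G.unit (T x) = G.unit x := by
  have : G.unit ∘ₗ (T : A →ₗ[ℝ] A) = G.unit := by
    refine G.toAbstractStateSpace.linearMap_ext fun w hw => ?_
    have hc := G.toAbstractStateSpace.mem_cone_of_mem_states hw
    refine le_antisymm ((G.isTransformation_of_reversible T hT).2 w hc) ?_
    have h := (G.isTransformation_of_reversible _ (G.reversible.inv_mem hT)).2 _
      (map_mem_cone hT hc)
    have h' : (T⁻¹ : A ≃ₗ[ℝ] A) (T w) = w := T.symm_apply_apply w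
    simpa [h'] using h
  exact LinearMap.congr_fun this x

theorem map_mem_states (hT : T ∈ G.reversible) {w : A} (hw : w ∈ G.states) : T w ∈ G.states := by
  refine (G.unit_eq_one_iff _ (map_mem_cone hT
    (G.toAbstractStateSpace.mem_cone_of_mem_states hw))).1 ?_
  rw [unit_map hT, G.toAbstractStateSpace.unit_of_mem_states hw]

theorem image_states (hT : T ∈ G.reversible) : T '' G.states = G.states := by
  refine Set.Subset.antisymm (by rintro _ ⟨w, hw, rfl⟩; exact map_mem_states hT hw) fun w hw => ?_
  exact ⟨T⁻¹ w, map_mem_states (G.reversible.inv_mem hT) hw, T.apply_symm_apply w⟩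

theorem map_mem_pureStates (hT : T ∈ G.reversible) {w : A} (hw : w ∈ G.pureStates) :
    T w ∈ G.pureStates := by
  have h := image_extremePoints (𝕜 := ℝ) T G.states
  rw [image_states hT] at h
  exact h.subset ⟨w, hw, rfl⟩

theorem IsFrame.map (hT : T ∈ G.reversible) {n : ℕ} {w : Fin n → A} (hw : G.IsFrame w) :
    G.IsFrame fun j => T (w j) := by
  obtain ⟨⟨hs, e, he, hsum, hδ⟩, hp⟩ := hw
  have hT' := G.reversible.inv_mem hT
  refine ⟨⟨fun j => map_mem_states hT (hs j),
    fun j => e j ∘ₗ ((T⁻¹ : A ≃ₗ[ℝ] A) : A →ₗ[ℝ] A), fun j => G.comp_allowed _ (he j) _ hT',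
    fun x hx => ?_, fun j k => ?_⟩, fun j => map_mem_pureStates hT (hp j)⟩
  · rw [← unit_map hT']
    exact hsum _ (map_mem_cone hT' hx)
  · have h' : (T⁻¹ : A ≃ₗ[ℝ] A) (T (w k)) = w k := T.symm_apply_apply _
    simpa [h'] using hδ j k

variable (G) in
/-- The reversible transformations are uniformly bounded. -/
theorem exists_norm_map_le : ∃ C : ℝ, ∀ T ∈ G.reversible, ∀ x : A, ‖T x‖ ≤ C * ‖x‖ := by
  obtain ⟨R, hR⟩ := G.isCompact_states.isBounded.exists_norm_le
  -- Orbits of states stay in the bounded set of states, and the states span, so every orbit is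
  -- bounded.
  have : ∀ x : A, ∃ C, ∀ T : G.reversible,
      ‖LinearMap.toContinuousLinearMap ((T : A ≃ₗ[ℝ] A) : A →ₗ[ℝ] A) x‖ ≤ C := by
    intro x
    obtain ⟨_, ⟨r, hr, w, hw, rfl⟩, _, ⟨s, hs, v, hv, rfl⟩, rfl⟩ := G.generating x
    refine ⟨r * R + s * R, fun T => ?_⟩
    have h1 := hR _ (map_mem_states T.2 hw)
    have h2 := hR _ (map_mem_states T.2 hv)
    simp only [LinearMap.coe_toContinuousLinearMap', LinearEquiv.coe_coe, map_sub, map_smul]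
    refine (norm_sub_le _ _).trans ?_
    rw [norm_smul, norm_smul, Real.norm_of_nonneg hr, Real.norm_of_nonneg hs]
    gcongr
  obtain ⟨C, hC⟩ := banach_steinhaus this
  exact ⟨C, fun T hT x => ContinuousLinearMap.le_of_opNorm_le _ (hC ⟨T, hT⟩) x⟩

variable (G) in
theorem exists_invariant_state : ∃ μ ∈ G.states, ∀ T ∈ G.reversible, T μ = μ := by
  obtain ⟨C, hC⟩ := G.exists_norm_map_le
  obtain ⟨μ, hμ, h⟩ := exists_fixedPoint_of_uniformlyBounded (H := G.reversible)
    (fun T => LinearMap.toContinuousLinearMap ((T : A ≃ₗ[ℝ] A) : A →ₗ[ℝ] A))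
    (fun x => rfl) (fun _ _ _ => rfl) (C := C) (fun T x => hC T T.2 x)
    G.isCompact_states.isClosed G.convex_states G.toAbstractStateSpace.states_nonempty
    (fun T x hx => map_mem_states T.2 hx)
  exact ⟨μ, hμ, fun T hT => h ⟨T, hT⟩⟩

variable (G) in
/-- There is an inner product that is invariant under the reversible transformations. -/
theorem exists_invariant_form : ∃ b : LinearMap.BilinForm ℝ A, (∀ x y, b x y = b y x) ∧
    (∀ x, x ≠ 0 → 0 < b x x) ∧ ∀ T ∈ G.reversible, ∀ x y, b (T x) (T y) = b x y := by
  obtain ⟨C, hC⟩ := G.exists_norm_map_le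
  let e := toEuclidean (E := A)
  -- Chosen so that the Euclidean form satisfies the lower bound in `K` along its whole orbit.
  let c : ℝ := (‖e.symm.toContinuousLinearMap‖ * |C| + 1)⁻¹ ^ 2
  have hc : 0 < c := by positivity
  -- Pulling back along inverses gives a left action on forms.
  let inv : G.reversible → A →L[ℝ] A := fun T =>
    LinearMap.toContinuousLinearMap (((T⁻¹ : G.reversible) : A ≃ₗ[ℝ] A) : A →ₗ[ℝ] A)
  -- The uniform lower bound is a closed condition that still forces definiteness; requiring it for
  -- all `T` makes `K` invariant.
  let K : Set (A →L[ℝ] A →L[ℝ] ℝ) := {b | (∀ x y, b x y = b y x) ∧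
    ∀ T : G.reversible, ∀ x, c * ‖x‖ ^ 2 ≤ b (inv T x) (inv T x)}
  have hcont : ∀ x y : A, Continuous fun b : A →L[ℝ] A →L[ℝ] ℝ => b x y := fun x y => by fun_prop
  have hKcl : IsClosed K := by
    simp only [K, Set.ofPred_and, Set.ofPred_forall]
    refine (isClosed_iInter fun x => isClosed_iInter fun y =>
      isClosed_eq (hcont _ _) (hcont _ _)).inter
      (isClosed_iInter fun T => isClosed_iInter fun x => isClosed_le continuous_const (hcont _ _))
  have hKconv : Convex ℝ K := by
    intro b hb b' hb' s t hs ht hst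
    refine ⟨fun x y => ?_, fun T x => ?_⟩
    · simp [hb.1 x y, hb'.1 x y]
    · have h1 := mul_le_mul_of_nonneg_left (hb.2 T x) hs
      have h2 := mul_le_mul_of_nonneg_left (hb'.2 T x) ht
      simp only [add_apply, smul_apply, smul_eq_mul]
      calc c * ‖x‖ ^ 2 = s * (c * ‖x‖ ^ 2) + t * (c * ‖x‖ ^ 2) := by rw [← add_mul, hst, one_mul]
        _ ≤ _ := add_le_add h1 h2
  have hKne : K.Nonempty := by
    refine ⟨(innerSL ℝ).bilinearComp e.toContinuousLinearMap e.toContinuousLinearMap,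
      fun x y => real_inner_comm (e y) (e x), fun T x => ?_⟩
    change c * ‖x‖ ^ 2 ≤ inner ℝ (e (inv T x)) (e (inv T x))
    rw [real_inner_self_eq_norm_sq, ← mul_pow]
    gcongr
    rw [inv_mul_le_iff₀ (by positivity)]
    have h1 : (T : A ≃ₗ[ℝ] A) (inv T x) = x := (T : A ≃ₗ[ℝ] A).apply_symm_apply x
    calc ‖x‖ = ‖(T : A ≃ₗ[ℝ] A) (inv T x)‖ := by rw [h1]
      _ ≤ |C| * ‖inv T x‖ := (hC _ T.2 _).trans (by gcongr; exact le_abs_self C)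
      _ = |C| * ‖e.symm (e (inv T x))‖ := by rw [e.symm_apply_apply]
      _ ≤ |C| * (‖e.symm.toContinuousLinearMap‖ * ‖e (inv T x)‖) := by
        gcongr
        exact e.symm.toContinuousLinearMap.le_opNorm _
      _ ≤ _ := by nlinarith [norm_nonneg (e (inv T x))]
  obtain ⟨b, hb, hfix⟩ := exists_fixedPoint_of_uniformlyBounded (H := G.reversible)
    (fun T => pullbackForm (inv T)) (fun x => rfl)
    (fun S T b => by
      ext x y
      simp only [pullbackForm_apply]
      simp [inv, mul_inv_rev])
    (C := |C| ^ 2) (fun T b => by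
      refine ContinuousLinearMap.opNorm_le_bound₂ _ (by positivity) fun x y => ?_
      rw [pullbackForm_apply]
      have hi : ∀ x, ‖inv T x‖ ≤ |C| * ‖x‖ := fun x =>
        (hC _ (T⁻¹).2 x).trans (by gcongr; exact le_abs_self C)
      calc ‖b (inv T x) (inv T y)‖ ≤ ‖b‖ * ‖inv T x‖ * ‖inv T y‖ := b.le_opNorm₂ _ _
        _ ≤ ‖b‖ * (|C| * ‖x‖) * (|C| * ‖y‖) := by gcongr <;> exact hi _
        _ = _ := by ring)
    hKcl hKconv hKne (fun T b hb => by
      refine ⟨fun x y => hb.1 (inv T x) (inv T y), fun S x => ?_⟩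
      have h := hb.2 (S * T) x
      simpa [inv, mul_inv_rev] using h)
  refine ⟨LinearMap.mk₂ ℝ (fun x y => b x y) (by simp) (by simp) (by simp) (by simp),
    fun x y => hb.1 x y, fun x hx => ?_, fun T hT x y => ?_⟩
  · have h := hb.2 1 x
    have h0 : 0 < c * ‖x‖ ^ 2 := by positivity
    exact h0.trans_le h
  · have h := congrArg (fun b' : A →L[ℝ] A →L[ℝ] ℝ => b' x y) (hfix (⟨T, hT⟩⁻¹ : G.reversible))
    simpa [inv] using h

end Reversible

/-! ### Frames and maximal frames -/

theorem PerfectlyDistinguishable.comp {m n : ℕ} {w : Fin n → A}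
    (hw : G.PerfectlyDistinguishable w) {ι : Fin m → Fin n} (hι : Function.Injective ι) :
    G.PerfectlyDistinguishable (w ∘ ι) := by
  obtain ⟨hs, e, he, hsum, hδ⟩ := hw
  refine ⟨fun j => hs _, fun j => e (ι j), fun j => he _, fun x hx => ?_, fun j k => ?_⟩
  · refine le_trans ?_ (hsum x hx)
    rw [← Finset.sum_image (s := Finset.univ) (g := ι) (f := fun i => e i x)
      (fun _ _ _ _ h => hι h)]
    exact Finset.sum_le_sum_of_subset_of_nonneg (Finset.subset_univ _)
      fun i _ _ => (G.isEffect_of_allowed _ (he i) x hx).1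
  · simp [hδ, hι.eq_iff]

theorem IsFrame.comp {m n : ℕ} {w : Fin n → A} (hw : G.IsFrame w) {ι : Fin m → Fin n}
    (hι : Function.Injective ι) : G.IsFrame (w ∘ ι) :=
  ⟨hw.1.comp hι, fun _ => hw.2 _⟩

theorem IsFrame.mem_states {n : ℕ} {w : Fin n → A} (hw : G.IsFrame w) (j : Fin n) :
    w j ∈ G.states := hw.1.1 j

theorem IsFrame.mem_cone {n : ℕ} {w : Fin n → A} (hw : G.IsFrame w) (j : Fin n) :
    w j ∈ G.cone := G.toAbstractStateSpace.mem_cone_of_mem_states (hw.mem_states j)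

theorem IsFrame.unit_apply {n : ℕ} {w : Fin n → A} (hw : G.IsFrame w) (j : Fin n) :
    G.unit (w j) = 1 := G.toAbstractStateSpace.unit_of_mem_states (hw.mem_states j)

theorem IsFrame.pair {n : ℕ} {w : Fin n → A} (hw : G.IsFrame w) {i j : Fin n} (hij : i ≠ j) :
    G.IsFrame ![w i, w j] := by
  have h : Function.Injective ![i, j] := by
    intro a b
    fin_cases a <;> fin_cases b <;> simp [hij, hij.symm]
  convert hw.comp h using 1
  ext a
  fin_cases a <;> rfl

/-- The distinguishing effects are dual to the frame, so each reads off one coefficient. -/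
theorem IsFrame.linearIndependent {n : ℕ} {w : Fin n → A} (hw : G.IsFrame w) :
    LinearIndependent ℝ w := by
  obtain ⟨⟨hs, e, he, hsum, hδ⟩, hp⟩ := hw
  rw [Fintype.linearIndependent_iff]
  intro c hc i
  simpa [hδ] using congrArg (e i) hc

theorem IsFrame.le_finrank {n : ℕ} {w : Fin n → A} (hw : G.IsFrame w) :
    n ≤ Module.finrank ℝ A := by
  simpa using hw.linearIndependent.fintype_card_le_finrank

theorem IsMaximalFrame.map {T : A ≃ₗ[ℝ] A} (hT : T ∈ G.reversible) {n : ℕ}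
    {w : Fin n → A} (hw : G.IsMaximalFrame w) : G.IsMaximalFrame fun j => T (w j) :=
  ⟨hw.1.map hT, hw.2⟩

variable (G) in
theorem exists_isMaximalFrame : ∃ (n : ℕ) (f : Fin n → A), G.IsMaximalFrame f := by
  let s : Set ℕ := {n | ∃ f : Fin n → A, G.IsFrame f}
  have hs : s.Nonempty := by
    refine ⟨0, ![], ⟨fun j => j.elim0, ![], fun j => j.elim0, fun x hx => ?_, fun j => j.elim0⟩,
      fun j => j.elim0⟩
    obtain ⟨r, hr, w, hw, rfl⟩ := hx
    simpa [G.toAbstractStateSpace.unit_of_mem_states hw] using hr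
  have hb : BddAbove s := ⟨Module.finrank ℝ A, by rintro n ⟨f, hf⟩; exact hf.le_finrank⟩
  obtain ⟨f, hf⟩ := Nat.sSup_mem hs hb
  exact ⟨_, f, hf, fun m v hv => le_csSup hb ⟨v, hv⟩⟩

/-- Every frame extends to a maximal frame. -/
theorem IsFrame.exists_extension (h₂ : G.StrongSymmetry) {m : ℕ} {w : Fin m → A}
    (hw : G.IsFrame w) : ∃ (n : ℕ) (hmn : m ≤ n) (f : Fin n → A), G.IsMaximalFrame f ∧
      ∀ j, f (Fin.castLE hmn j) = w j := by
  obtain ⟨n, f, hf⟩ := G.exists_isMaximalFrame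
  have hmn := hf.2 m w hw
  -- Move the first `m` members of an arbitrary maximal frame onto `w`; the remaining members come
  -- along.
  obtain ⟨T, hT, h⟩ := h₂ m _ w (hf.1.comp (Fin.castLE_injective hmn)) hw
  exact ⟨n, hmn, _, hf.map hT, h⟩

/-- The coefficients of a classical decomposition, padded by zeros, give a decomposition into a
maximal frame. -/
theorem IsClassicalDecomposition.exists_isMaximalFrame (h₂ : G.StrongSymmetry) {m : ℕ} {w : A}
    {p : Fin m → ℝ} {v : Fin m → A} (h : G.IsClassicalDecomposition w p v) :
    ∃ (n : ℕ) (q : Fin n → ℝ) (f : Fin n → A), G.IsMaximalFrame f ∧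
      G.IsClassicalDecomposition w q f ∧ shannon q = shannon p := by
  obtain ⟨hp, hv, rfl⟩ := h
  obtain ⟨n, hmn, f, hf, hfv⟩ := hv.exists_extension h₂
  let ι := Fin.castLE hmn
  have hι : Function.Injective ι := Fin.castLE_injective hmn
  let q := Function.extend ι p 0
  have hq : ∀ j, q (ι j) = p j := fun j => hι.extend_apply p 0 j
  have hq' : ∀ i, i ∉ Set.range ι → q i = 0 := fun i hi => Function.extend_apply' _ _ _ hi
  refine ⟨n, q, f, hf, ⟨⟨fun i => ?_, ?_⟩, hf.1, ?_⟩, ?_⟩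
  · by_cases hi : i ∈ Set.range ι
    · obtain ⟨j, rfl⟩ := hi
      rw [hq]
      exact hp.1 j
    · exact (hq' i hi).ge
  · rw [← hp.2]
    exact (Fintype.sum_of_injective ι hι p q hq' fun j => (hq j).symm).symm
  · exact Fintype.sum_of_injective ι hι _ _ (fun i hi => by simp [hq' i hi]) fun j => by
      rw [hq, hfv]
  · exact (Fintype.sum_of_injective ι hι _ _ (fun i hi => by simp [hq' i hi]) fun j => by
      rw [hq]).symm

theorem exists_decomposition_isMaximalFrame (h₁ : G.ClassicalDecomposability)
    (h₂ : G.StrongSymmetry) {w : A} (hw : w ∈ G.states) :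
    ∃ (n : ℕ) (q : Fin n → ℝ) (f : Fin n → A), G.IsMaximalFrame f ∧
      G.IsClassicalDecomposition w q f := by
  obtain ⟨m, p, v, h⟩ := h₁ w hw
  obtain ⟨n, q, f, hf, hq, -⟩ := h.exists_isMaximalFrame h₂
  exact ⟨n, q, f, hf, hq⟩

theorem IsMaximalFrame.card_unique {m n : ℕ} {f : Fin m → A} {g : Fin n → A}
    (hf : G.IsMaximalFrame f) (hg : G.IsMaximalFrame g) : m = n :=
  le_antisymm (hg.2 _ _ hf.1) (hf.2 _ _ hg.1)

/-- Every pure state belongs to a maximal frame. -/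
theorem exists_isMaximalFrame_of_pure (h₁ : G.ClassicalDecomposability) (h₂ : G.StrongSymmetry)
    {w : A} (hw : w ∈ G.pureStates) :
    ∃ (n : ℕ) (f : Fin n → A) (j : Fin n), G.IsMaximalFrame f ∧ f j = w := by
  obtain ⟨n, q, f, hf, hq, -, rfl⟩ := exists_decomposition_isMaximalFrame h₁ h₂ hw.1
  have hsub : convexHull ℝ (Set.range f) ⊆ G.states :=
    convexHull_min (by rintro _ ⟨j, rfl⟩; exact hf.1.mem_states j) G.convex_states
  have hmem : ∑ j, q j • f j ∈ convexHull ℝ (Set.range f) :=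
    (convex_convexHull ℝ _).sum_mem (fun i _ => hq.1 i) hq.2
      fun i _ => subset_convexHull ℝ _ ⟨i, rfl⟩
  -- An extreme state in the convex hull of a frame is extreme in that hull, hence a member of the
  -- frame.
  obtain ⟨j, hj⟩ := extremePoints_convexHull_subset
    (inter_extremePoints_subset_extremePoints_of_subset hsub ⟨hmem, hw⟩)
  exact ⟨n, f, j, hf, hj⟩

/-! ### Spectral decomposition -/

/-- The states of all maximal frames have the same sum. -/
theorem IsMaximalFrame.sum_eq (h₁ : G.ClassicalDecomposability) (h₂ : G.StrongSymmetry)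
    {m n : ℕ} {f : Fin m → A} {g : Fin n → A} (hf : G.IsMaximalFrame f)
    (hg : G.IsMaximalFrame g) : ∑ j, f j = ∑ j, g j := by
  obtain ⟨μ, hμ, hinv⟩ := G.exists_invariant_state
  obtain ⟨k, p, v, hv, hp, -, hpv⟩ := exists_decomposition_isMaximalFrame h₁ h₂ hμ
  -- A transposition of the frame extends to some `T` fixing `μ`; linear independence then equates
  -- the two weights.
  have hconst : ∀ i j, p i = p j := by
    intro i j
    let σ := Equiv.swap i j
    obtain ⟨T, hT, h⟩ := h₂ k v (v ∘ σ) hv.1 (hv.1.comp σ.injective)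
    have h1 : ∑ l, p l • v l = ∑ l, p (σ l) • v l := by
      rw [← hpv]
      conv_lhs => rw [← hinv T hT, hpv]
      simp only [map_sum, map_smul, h]
      rw [← Equiv.sum_comp σ]
      simp [σ]
    have h2 := Fintype.linearIndependent_iff.1 hv.1.linearIndependent (fun l => p l - p (σ l))
      (by simp only [sub_smul, Finset.sum_sub_distrib, h1, sub_self]) i
    have h3 : σ i = j := Equiv.swap_apply_left i j
    rw [h3] at h2
    linarith
  have hsum : ∑ j, v j = (k : ℝ) • μ := by
    rw [hpv, Finset.smul_sum]
    refine Finset.sum_congr rfl fun j _ => ?_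
    have h1 : (k : ℝ) * p j = 1 := by
      rw [← hp.2, Finset.sum_congr rfl fun i _ => hconst i j]
      simp
    rw [smul_smul, h1, one_smul]
  have key : ∀ (l : ℕ) (h : Fin l → A), G.IsMaximalFrame h → ∑ j, h j = (k : ℝ) • μ := by
    intro l h hh
    obtain rfl := hh.card_unique hv
    obtain ⟨T, hT, hTv⟩ := h₂ l v h hv.1 hh.1
    rw [← Finset.sum_congr rfl fun j _ => hTv j, ← map_sum, hsum, map_smul, hinv T hT]
  rw [key _ _ hf, key _ _ hg]

/-- Every vector is a linear combination of the states of a maximal frame. -/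
theorem exists_spectral_decomposition (h₁ : G.ClassicalDecomposability) (h₂ : G.StrongSymmetry)
    (x : A) : ∃ (n : ℕ) (f : Fin n → A) (c : Fin n → ℝ), G.IsMaximalFrame f ∧
      x = ∑ j, c j • f j := by
  have hcone : ∀ x ∈ G.cone, ∃ (n : ℕ) (f : Fin n → A) (c : Fin n → ℝ), G.IsMaximalFrame f ∧
      x = ∑ j, c j • f j := by
    rintro _ ⟨r, hr, w, hw, rfl⟩
    obtain ⟨n, q, f, hf, hq, -, rfl⟩ := exists_decomposition_isMaximalFrame h₁ h₂ hw
    exact ⟨n, f, fun j => r * q j, hf, by simp [Finset.smul_sum, smul_smul]⟩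
  obtain ⟨y, hy, _, ⟨r, hr, w, hw, rfl⟩, rfl⟩ := G.generating x
  obtain ⟨n, q, g, hg, hq, -, rfl⟩ := exists_decomposition_isMaximalFrame h₁ h₂ hw
  have hq1 : ∀ j, q j ≤ 1 := fun j => by
    rw [← hq.2]
    exact Finset.single_le_sum (fun i _ => hq.1 i) (Finset.mem_univ j)
  -- This vector is `x + r • ∑ j, g j` for the given `x`. Since all maximal frames have the same
  -- sum, the shift can be removed in the new frame `f`.
  have hmem : y + r • ∑ j, (1 - q j) • g j ∈ G.cone :=
    G.isCone.add_mem _ hy _ (G.isCone.smul_mem r hr _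
      (G.toAbstractStateSpace.sum_mem_cone _ _ fun j _ =>
        G.isCone.smul_mem _ (sub_nonneg.2 (hq1 j)) _ (hg.1.mem_cone j)))
  obtain ⟨m, f, c, hf, hc⟩ := hcone _ hmem
  refine ⟨m, f, fun j => c j - r, hf, ?_⟩
  simp only [sub_smul, Finset.sum_sub_distrib, ← hc, ← Finset.smul_sum, one_smul, smul_sub,
    hf.sum_eq h₁ h₂ hg]
  abel

/-! ### The inner product making frames orthonormal -/

variable (G) in
/-- Every frame is orthonormal for the bilinear form `B`. -/
def OrthonormalOnFrames (B : LinearMap.BilinForm ℝ A) : Prop :=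
  ∀ (n : ℕ) (f : Fin n → A), G.IsFrame f → ∀ i j, B (f i) (f j) = if i = j then 1 else 0

theorem OrthonormalOnFrames.apply_sum {B : LinearMap.BilinForm ℝ A}
    (hB : G.OrthonormalOnFrames B) {n : ℕ} {f : Fin n → A} (hf : G.IsFrame f) (c : Fin n → ℝ)
    (i : Fin n) : B (f i) (∑ j, c j • f j) = c i := by
  simp [hB n f hf]

theorem OrthonormalOnFrames.sum_apply_sum {B : LinearMap.BilinForm ℝ A}
    (hB : G.OrthonormalOnFrames B) {n : ℕ} {f : Fin n → A} (hf : G.IsFrame f) (c : Fin n → ℝ) :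
    B (∑ j, c j • f j) (∑ j, c j • f j) = ∑ j, c j ^ 2 := by
  have h : ∀ y, B (∑ j, c j • f j) y = ∑ j, c j * B (f j) y := fun y => by simp
  rw [h]
  exact Finset.sum_congr rfl fun i _ => by rw [hB.apply_sum hf, sq]

/-- There is an invariant bilinear form for which all frames are orthonormal. -/
theorem exists_orthonormalOnFrames (h₁ : G.ClassicalDecomposability) (h₂ : G.StrongSymmetry) :
    ∃ B : LinearMap.BilinForm ℝ A, G.OrthonormalOnFrames B ∧ (∀ x y, B x y = B y x) ∧
      ∀ T ∈ G.reversible, ∀ x y, B (T x) (T y) = B x y := by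
  obtain ⟨b, hsymm, hpos, hinv⟩ := G.exists_invariant_form
  have hpure : ∀ w ∈ G.pureStates, G.IsFrame ![w] := by
    intro w hw
    obtain ⟨n, f, j, hf, rfl⟩ := exists_isMaximalFrame_of_pure h₁ h₂ hw
    convert hf.1.comp (ι := ![j]) (Function.injective_of_subsingleton _) using 1
    ext a
    fin_cases a
    rfl
  obtain ⟨α, hα0, hα⟩ : ∃ α : ℝ, 0 < α ∧ ∀ w ∈ G.pureStates, b w w = α := by
    by_cases h : ∃ w₀, w₀ ∈ G.pureStates
    · obtain ⟨w₀, hw₀⟩ := h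
      refine ⟨b w₀ w₀, hpos _ ?_, fun w hw => ?_⟩
      · rintro rfl
        simpa using G.toAbstractStateSpace.unit_of_mem_states hw₀.1
      · obtain ⟨T, hT, h⟩ := h₂ 1 _ _ (hpure w₀ hw₀) (hpure w hw)
        have h0 : T w₀ = w := h 0
        rw [← h0, hinv T hT]
    · exact ⟨1, one_pos, fun w hw => (h ⟨w, hw⟩).elim⟩
  -- Positivity of `b` on `w₀ - v₀` reads `2α - 2β > 0`. Without 2-frames any `β < α` serves.
  obtain ⟨β, hβα, hβ⟩ : ∃ β : ℝ, β < α ∧ ∀ w v, G.IsFrame ![w, v] → b w v = β := by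
    by_cases h : ∃ w₀ v₀, G.IsFrame ![w₀, v₀]
    · obtain ⟨w₀, v₀, h₀⟩ := h
      refine ⟨b w₀ v₀, ?_, fun w v hwv => ?_⟩
      · have hne : w₀ - v₀ ≠ 0 := fun h => by
          have := h₀.linearIndependent.injective.ne (a₁ := 0) (a₂ := 1) (by decide)
          exact this (sub_eq_zero.1 h)
        have h1 := hpos _ hne
        have hw := hα w₀ (h₀.2 0)
        have hv := hα v₀ (h₀.2 1)
        simp only [map_sub, LinearMap.sub_apply, hw, hv, hsymm v₀ w₀] at h1
        linarith
      · obtain ⟨T, hT, h⟩ := h₂ 2 _ _ h₀ hwv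
        have hw : T w₀ = w := h 0
        have hv : T v₀ = v := h 1
        rw [← hw, ← hv, hinv T hT]
    · exact ⟨0, hα0, fun w v hwv => (h ⟨w, v, hwv⟩).elim⟩
  have hne : α - β ≠ 0 := (sub_pos.2 hβα).ne'
  -- On states `u ⊗ u` equals 1, so the values `α` and `β` become 1 and 0. Definiteness is no longer
  -- evident and is recovered in `OrthonormalOnFrames.pos`.
  let B : LinearMap.BilinForm ℝ A :=
    (α - β)⁻¹ • (b - β • LinearMap.BilinForm.linMulLin G.unit G.unit)
  have hBapp : ∀ x y, B x y = (α - β)⁻¹ * (b x y - β * (G.unit x * G.unit y)) := fun x y => by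
    simp [B]
  refine ⟨B, fun n f hf i j => ?_, fun x y => ?_, fun T hT x y => ?_⟩
  · rw [hBapp, hf.unit_apply, hf.unit_apply]
    split_ifs with h
    · subst h
      rw [hα _ (hf.2 i)]
      field_simp
    · rw [hβ _ _ (hf.pair h)]
      ring
  · rw [hBapp, hBapp, hsymm, mul_comm (G.unit x)]
  · rw [hBapp, hBapp, hinv T hT, unit_map hT, unit_map hT]

theorem OrthonormalOnFrames.pos (h₁ : G.ClassicalDecomposability) (h₂ : G.StrongSymmetry)
    {B : LinearMap.BilinForm ℝ A} (hB : G.OrthonormalOnFrames B) {x : A} (hx : x ≠ 0) :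
    0 < B x x := by
  obtain ⟨n, f, c, hf, rfl⟩ := exists_spectral_decomposition h₁ h₂ x
  rw [hB.sum_apply_sum hf.1]
  refine lt_of_le_of_ne (Finset.sum_nonneg fun i _ => sq_nonneg _) fun h => hx ?_
  have h0 := (Finset.sum_eq_zero_iff_of_nonneg fun i _ => sq_nonneg (c i)).1 h.symm
  exact Finset.sum_eq_zero fun i hi => by rw [pow_eq_zero_iff two_ne_zero |>.1 (h0 i hi), zero_smul]

/-- The squares of real numbers with vanishing sum whose positive parts add up to at most one
add up to at most two. -/
theorem sum_sq_le_two {ι : Type*} [Fintype ι] (c : ι → ℝ) (h0 : ∑ i, c i = 0)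
    (h1 : ∑ i, max (c i) 0 ≤ 1) : ∑ i, c i ^ 2 ≤ 2 := by
  have h2 : ∑ i, max (-c i) 0 = ∑ i, max (c i) 0 := by
    have h3 : ∑ i, (max (c i) 0 - max (-c i) 0) = ∑ i, c i := by
      refine Finset.sum_congr rfl fun i _ => ?_
      rcases le_total (c i) 0 with h | h
      · rw [max_eq_right h, max_eq_left (by linarith)]; ring
      · rw [max_eq_left h, max_eq_right (by linarith)]; ring
    rw [Finset.sum_sub_distrib] at h3
    linarith
  have hle : ∀ i, c i ^ 2 ≤ max (c i) 0 + max (-c i) 0 := by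
    intro i
    have h3 : max (c i) 0 ≤ 1 := (Finset.single_le_sum (f := fun i => max (c i) 0)
      (fun i _ => le_max_right _ _) (Finset.mem_univ i)).trans h1
    have h4 : max (-c i) 0 ≤ 1 := (Finset.single_le_sum (f := fun i => max (-c i) 0)
      (fun i _ => le_max_right _ _) (Finset.mem_univ i)).trans (h2.trans_le h1)
    rcases le_total (c i) 0 with h | h
    · rw [max_eq_right h, max_eq_left (by linarith)]
      rw [max_eq_left (by linarith)] at h4
      nlinarith
    · rw [max_eq_left h, max_eq_right (by linarith)]
      rw [max_eq_left h] at h3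
      nlinarith
  calc ∑ i, c i ^ 2 ≤ ∑ i, (max (c i) 0 + max (-c i) 0) := Finset.sum_le_sum fun i _ => hle i
    _ ≤ 2 := by rw [Finset.sum_add_distrib, h2]; linarith

/-- Since `B (w - v) (w - v) = 2 - 2 * B w v`, it suffices to bound the squared spectral
coefficients of `w - v` by 2 in total. -/
theorem OrthonormalOnFrames.nonneg_of_pure (h₁ : G.ClassicalDecomposability)
    (h₂ : G.StrongSymmetry) {B : LinearMap.BilinForm ℝ A} (hB : G.OrthonormalOnFrames B)
    (hsymm : ∀ x y, B x y = B y x) {w v : A} (hw : w ∈ G.pureStates) (hv : v ∈ G.pureStates) :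
    0 ≤ B w v := by
  have hone : ∀ w ∈ G.pureStates, B w w = 1 := by
    intro w hw
    obtain ⟨n, f, j, hf, rfl⟩ := exists_isMaximalFrame_of_pure h₁ h₂ hw
    simp [hB n f hf.1]
  obtain ⟨n, f, c, hf, hc⟩ := exists_spectral_decomposition h₁ h₂ (w - v)
  have h0 : ∑ j, c j = 0 := by
    have := congrArg G.unit hc
    simpa [hf.1.unit_apply, G.toAbstractStateSpace.unit_of_mem_states hw.1,
      G.toAbstractStateSpace.unit_of_mem_states hv.1] using this.symm
  -- The effects of the frame give `c j = e j w - e j v ≤ e j w`, and `∑ j, e j w ≤ 1`.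
  have h1 : ∑ j, max (c j) 0 ≤ 1 := by
    obtain ⟨hs, e, he, hsum, hδ⟩ := hf.1.1
    have hwc := G.toAbstractStateSpace.mem_cone_of_mem_states hw.1
    have hvc := G.toAbstractStateSpace.mem_cone_of_mem_states hv.1
    have hec : ∀ j, c j = e j w - e j v := fun j => by
      rw [← map_sub, hc]
      simp [hδ]
    rw [← G.toAbstractStateSpace.unit_of_mem_states hw.1]
    refine le_trans (Finset.sum_le_sum fun j _ => ?_) (hsum w hwc)
    have h2 := (G.isEffect_of_allowed _ (he j) w hwc).1
    have h3 := (G.isEffect_of_allowed _ (he j) v hvc).1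
    exact max_le (by rw [hec]; linarith) h2
  have h2 : B (w - v) (w - v) ≤ 2 := by
    rw [hc, hB.sum_apply_sum hf.1]
    exact sum_sq_le_two c h0 h1
  simp only [map_sub, LinearMap.sub_apply, hone w hw, hone v hv, hsymm v w] at h2
  linarith

theorem OrthonormalOnFrames.nonneg (h₁ : G.ClassicalDecomposability)
    (h₂ : G.StrongSymmetry) {B : LinearMap.BilinForm ℝ A} (hB : G.OrthonormalOnFrames B)
    (hsymm : ∀ x y, B x y = B y x) {x y : A} (hx : x ∈ G.cone) (hy : y ∈ G.cone) :
    0 ≤ B x y := by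
  obtain ⟨r, hr, w, hw, rfl⟩ := hx
  obtain ⟨s, hs, v, hv, rfl⟩ := hy
  obtain ⟨n, p, f, hp, hf, rfl⟩ := h₁ w hw
  obtain ⟨m, q, g, hq, hg, rfl⟩ := h₁ v hv
  simp only [map_smul, map_sum, LinearMap.smul_apply, LinearMap.sum_apply, smul_eq_mul]
  refine mul_nonneg hs (Finset.sum_nonneg fun j _ => mul_nonneg (hq.1 j)
    (mul_nonneg hr (Finset.sum_nonneg fun i _ => mul_nonneg (hp.1 i) ?_)))
  exact hB.nonneg_of_pure h₁ h₂ hsymm (hf.2 i) (hg.2 j)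

theorem eq_zero_of_sum_mul_eq_zero {ι : Type*} [Fintype ι] {p x : ι → ℝ} (hp : ∀ i, 0 ≤ p i)
    (hx : ∀ i, 0 ≤ x i) (h : ∑ i, p i * x i = 0) {i : ι} (hi : p i ≠ 0) : x i = 0 := by
  have := (Finset.sum_eq_zero_iff_of_nonneg fun i _ => mul_nonneg (hp i) (hx i)).1 h i
    (Finset.mem_univ i)
  exact (mul_eq_zero.1 this).resolve_left hi

/-- Effects that distinguish two mixtures also distinguish their pure components of nonzero weight,
so these components form 2-frames. -/
theorem OrthonormalOnFrames.orthogonal (h₁ : G.ClassicalDecomposability)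
    {B : LinearMap.BilinForm ℝ A} (hB : G.OrthonormalOnFrames B) {w v : A}
    (h : G.PerfectlyDistinguishable ![w, v]) : B w v = 0 := by
  obtain ⟨hs, e, he, hsum, hδ⟩ := h
  obtain ⟨n, p, f, hp, hf, hw⟩ := h₁ w (hs 0)
  obtain ⟨m, q, g, hq, hg, hv⟩ := h₁ v (hs 1)
  have e_nonneg : ∀ j, ∀ x ∈ G.cone, 0 ≤ e j x := fun j x hx =>
    (G.isEffect_of_allowed _ (he j) x hx).1
  have e_le : ∀ j, ∀ x ∈ G.cone, e j x ≤ G.unit x := fun j x hx =>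
    (G.isEffect_of_allowed _ (he j) x hx).2
  -- An effect attains 0 or 1 on a mixture only if it does so on every component of nonzero weight.
  have key : ∀ {k : ℕ} {r : Fin k → ℝ} {h : Fin k → A} {x : A}, r ∈ stdSimplex ℝ (Fin k) →
      G.IsFrame h → x = ∑ i, r i • h i → ∀ i, r i ≠ 0 → ∀ j,
      (e j x = 0 → e j (h i) = 0) ∧ (e j x = 1 → e j (h i) = 1) := by
    rintro k r h x hr hh rfl i hi j
    refine ⟨fun h0 => ?_, fun h1 => ?_⟩
    · refine eq_zero_of_sum_mul_eq_zero hr.1 (fun i => e_nonneg j _ (hh.mem_cone i)) ?_ hi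
      simpa using h0
    · have h2 : 1 - e j (h i) = 0 := by
        refine eq_zero_of_sum_mul_eq_zero (x := fun i => 1 - e j (h i)) hr.1 (fun i => ?_) ?_ hi
        · have := e_le j _ (hh.mem_cone i)
          rw [hh.unit_apply] at this
          linarith
        · simp only [mul_sub, Finset.sum_sub_distrib, mul_one, hr.2]
          simp only [map_sum, map_smul, smul_eq_mul] at h1
          linarith
      linarith
  rw [hw, hv]
  simp only [map_smul, map_sum, LinearMap.smul_apply, LinearMap.sum_apply, smul_eq_mul]
  refine Finset.sum_eq_zero fun j _ => ?_
  by_cases hj : q j = 0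
  · simp [hj]
  refine mul_eq_zero_of_right _ (Finset.sum_eq_zero fun i _ => ?_)
  by_cases hi : p i = 0
  · simp [hi]
  refine mul_eq_zero_of_right _ ?_
  have hfr : G.IsFrame ![f i, g j] := by
    refine ⟨⟨fun a => ?_, e, he, hsum, fun a b => ?_⟩, fun a => ?_⟩
    · fin_cases a
      exacts [hf.mem_states i, hg.mem_states j]
    · fin_cases a <;> fin_cases b
      · exact (key hp hf hw i hi 0).2 (by simpa using hδ 0 0)
      · exact (key hq hg hv j hj 0).1 (by simpa using hδ 0 1)
      · exact (key hp hf hw i hi 1).1 (by simpa using hδ 1 0)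
      · exact (key hq hg hv j hj 1).2 (by simpa using hδ 1 1)
    · fin_cases a
      exacts [hf.2 i, hg.2 j]
  simpa using hB 2 _ hfr 0 1

/-! ### Self-duality -/

theorem exists_isSelfDualizing (h₁ : G.ClassicalDecomposability) (h₂ : G.StrongSymmetry) :
    ∃ B : LinearMap.BilinForm ℝ A, G.IsSelfDualizing B := by
  obtain ⟨B, hB, hsymm, hinv⟩ := exists_orthonormalOnFrames h₁ h₂
  have hcone : ∀ {w}, w ∈ G.states → w ∈ G.cone :=
    G.toAbstractStateSpace.mem_cone_of_mem_states
  have hself : ∀ w ∈ G.states, B w w ≤ 1 := by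
    intro w hw
    obtain ⟨n, q, f, hf, hq, -, rfl⟩ := exists_decomposition_isMaximalFrame h₁ h₂ hw
    rw [hB.sum_apply_sum hf.1, ← hq.2]
    refine Finset.sum_le_sum fun i _ => ?_
    have h1 : q i ≤ 1 := by
      rw [← hq.2]
      exact Finset.single_le_sum (fun i _ => hq.1 i) (Finset.mem_univ i)
    nlinarith [hq.1 i]
  have hdef : ∀ x, B x x = 0 → x = 0 := fun x h0 => by
    by_contra hx
    exact (hB.pos h₁ h₂ hx).ne' h0
  have hnd : B.Nondegenerate := ⟨fun x h => hdef x (h x), fun x h => hdef x (h x)⟩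
  refine ⟨B, hsymm, fun x hx => hB.pos h₁ h₂ hx, ?_, hinv, fun w hw v hv =>
    ⟨hB.nonneg h₁ h₂ hsymm (hcone hw) (hcone hv), ?_⟩, fun w hw => ?_, fun v hv hvp => ?_,
    fun w v h => hB.orthogonal h₁ h⟩
  · ext e
    refine ⟨fun he => ?_, ?_⟩
    · obtain ⟨y, rfl⟩ := (B.toDual hnd).surjective e
      obtain ⟨n, f, c, hf, hc⟩ := exists_spectral_decomposition h₁ h₂ y
      refine ⟨y, ?_, fun x => by rw [LinearMap.BilinForm.toDual_def, hsymm]⟩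
      rw [hc]
      refine G.toAbstractStateSpace.sum_mem_cone _ _ fun j _ =>
        G.isCone.smul_mem _ ?_ _ (hf.1.mem_cone j)
      -- The spectral coefficient `c j` is the value of the positive functional at `f j`.
      have := he _ (hf.1.mem_cone j)
      rwa [LinearMap.BilinForm.toDual_def, hsymm, hc, hB.apply_sum hf.1] at this
    · rintro ⟨w, hw, hew⟩ x hx
      rw [hew]
      exact hB.nonneg h₁ h₂ hsymm hx hw
  · have h0 : 0 ≤ B (w - v) (w - v) := by
      by_cases hne : w - v = 0
      · simp [hne]
      · exact (hB.pos h₁ h₂ hne).le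
    simp only [map_sub, LinearMap.sub_apply, hsymm v w] at h0
    linarith [hself w hw, hself v hv]
  · obtain ⟨n, f, j, hf, rfl⟩ := exists_isMaximalFrame_of_pure h₁ h₂ hw
    simp [hB n f hf.1]
  · refine lt_of_le_of_ne (hself v hv) fun heq => hvp ?_
    obtain ⟨n, q, f, hf, hq, -, rfl⟩ := exists_decomposition_isMaximalFrame h₁ h₂ hv
    rw [hB.sum_apply_sum hf.1, ← sub_eq_zero, ← hq.2, ← Finset.sum_sub_distrib] at heq
    have h1 : ∀ i, q i ≤ 1 := fun i => by
      rw [← hq.2]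
      exact Finset.single_le_sum (fun i _ => hq.1 i) (Finset.mem_univ i)
    -- Equality forces `q i ^ 2 = q i` for all `i`, so one weight is 1 and the state is a member of
    -- the frame.
    have h2 := (Finset.sum_eq_zero_iff_of_nonpos fun i _ => by nlinarith [hq.1 i, h1 i]).1 heq
    obtain ⟨j, hj⟩ : ∃ j, q j ≠ 0 := by
      by_contra! h
      simpa [h] using hq.2
    have hj1 : q j = 1 := by
      have := h2 j (Finset.mem_univ j)
      have h3 : q j * (q j - 1) = 0 := by linarith
      linarith [(mul_eq_zero.1 h3).resolve_left hj]
    have hrest : ∀ i, i ≠ j → q i = 0 := by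
      intro i hij
      have h3 := hq.2
      rw [← Finset.add_sum_erase _ _ (Finset.mem_univ j), hj1, add_eq_left] at h3
      exact (Finset.sum_eq_zero_iff_of_nonneg fun i _ => hq.1 i).1 h3 i
        (Finset.mem_erase.2 ⟨hij, Finset.mem_univ i⟩)
    rw [Finset.sum_eq_single j (fun i _ hij => by rw [hrest i hij, zero_smul]) (by simp), hj1,
      one_smul]
    exact hf.1.2 j

theorem IsSelfDualizing.orthonormalOnFrames {B : LinearMap.BilinForm ℝ A}
    (hB : G.IsSelfDualizing B) : G.OrthonormalOnFrames B := by
  intro n f hf i j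
  split_ifs with h
  · rw [h]
    exact hB.pure _ (hf.2 j)
  · exact hB.orthogonal _ _ (hf.pair h).1

/-! ### Entropy inequalities -/

/-- The transition probabilities between a state and the members of a maximal frame add up to
one. -/
theorem IsSelfDualizing.sum_apply_eq_one (h₁ : G.ClassicalDecomposability)
    (h₂ : G.StrongSymmetry) {B : LinearMap.BilinForm ℝ A} (hB : G.IsSelfDualizing B) {n : ℕ}
    {f : Fin n → A} (hf : G.IsMaximalFrame f) {w : A} (hw : w ∈ G.states) :
    ∑ k, B w (f k) = 1 := by
  obtain ⟨m, q, g, hg, hq, -, rfl⟩ := exists_decomposition_isMaximalFrame h₁ h₂ hw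
  have h : ∀ y, B (∑ j, g j) y = ∑ j, B (g j) y := fun y => by simp
  rw [← map_sum, hf.sum_eq h₁ h₂ hg, hB.symm, h, ← hq.2]
  exact Finset.sum_congr rfl fun i _ => hB.orthonormalOnFrames.apply_sum hg.1 q i

/-- The Shannon entropy of a classical decomposition is at most that of the transition
probabilities to any maximal frame. -/
theorem IsSelfDualizing.shannon_le (h₁ : G.ClassicalDecomposability) (h₂ : G.StrongSymmetry)
    {B : LinearMap.BilinForm ℝ A} (hB : G.IsSelfDualizing B) {w : A} {m n : ℕ} {p : Fin m → ℝ}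
    {v : Fin m → A} (hw : G.IsClassicalDecomposition w p v) {f : Fin n → A}
    (hf : G.IsMaximalFrame f) : shannon p ≤ shannon fun k => B w (f k) := by
  obtain ⟨l, q, g, hg, ⟨hq, -, rfl⟩, hpq⟩ := hw.exists_isMaximalFrame h₂
  rw [← hpq]
  -- Unit column sums supply Jensen weights for each `k`; unit row sums collapse the double sum at
  -- the end.
  have hcol : ∀ k, ∑ j, B (g j) (f k) = 1 := fun k => by
    rw [← hB.sum_apply_eq_one h₁ h₂ hg (hf.1.mem_states k)]
    exact Finset.sum_congr rfl fun j _ => hB.symm _ _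
  have hk : ∀ k, ∑ j, B (g j) (f k) * Real.negMulLog (q j) ≤
      Real.negMulLog (B (∑ j, q j • g j) (f k)) := by
    intro k
    have h := Real.concaveOn_negMulLog.le_map_sum (t := Finset.univ)
      (w := fun j => B (g j) (f k)) (p := q)
      (fun j _ => (hB.mem_unitInterval _ (hg.1.mem_states j) _ (hf.1.mem_states k)).1)
      (hcol k) (fun j _ => hq.1 j)
    have h' : B (∑ j, q j • g j) (f k) = ∑ j, B (g j) (f k) * q j := by
      simp [mul_comm]
    rw [h']
    simpa only [smul_eq_mul] using h
  refine le_trans (le_of_eq ?_) (Finset.sum_le_sum fun k _ => hk k)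
  rw [Finset.sum_comm]
  refine Finset.sum_congr rfl fun j _ => ?_
  rw [← Finset.sum_mul, hB.sum_apply_eq_one h₁ h₂ hf (hg.1.mem_states j), one_mul]

/-- In the frame that decomposes `w`, the transition probabilities are the coefficients themselves.
-/
theorem shannon_le_shannon (h₁ : G.ClassicalDecomposability) (h₂ : G.StrongSymmetry) {w : A}
    {m n : ℕ} {p : Fin m → ℝ} {v : Fin m → A} (hp : G.IsClassicalDecomposition w p v)
    {q : Fin n → ℝ} {f : Fin n → A} (hq : G.IsClassicalDecomposition w q f) :
    shannon p ≤ shannon q := by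
  obtain ⟨B, hB⟩ := exists_isSelfDualizing h₁ h₂
  obtain ⟨l, q', g, hg, ⟨hq', -, rfl⟩, hqq⟩ := hq.exists_isMaximalFrame h₂
  rw [← hqq]
  refine (hB.shannon_le h₁ h₂ hp hg).trans_eq (congrArg shannon (funext fun k => ?_))
  rw [hB.symm, hB.orthonormalOnFrames.apply_sum hg.1]

theorem entropy_eq_shannon (h₁ : G.ClassicalDecomposability) (h₂ : G.StrongSymmetry) {w : A}
    {n : ℕ} {p : Fin n → ℝ} {v : Fin n → A} (hp : G.IsClassicalDecomposition w p v) :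
    G.entropy w = shannon p := by
  obtain ⟨m, q, f, hq, h⟩ := Classical.epsilon_spec
    (p := fun s : ℝ => ∃ (n : ℕ) (p : Fin n → ℝ) (v : Fin n → A),
      G.IsClassicalDecomposition w p v ∧ s = shannon p) ⟨_, n, p, v, hp, rfl⟩
  exact h.trans (le_antisymm (shannon_le_shannon h₁ h₂ hq hp) (shannon_le_shannon h₁ h₂ hp hq))

theorem IsSelfDualizing.entropy_le (h₁ : G.ClassicalDecomposability) (h₂ : G.StrongSymmetry)
    {B : LinearMap.BilinForm ℝ A} (hB : G.IsSelfDualizing B) {w : A} (hw : w ∈ G.states) {n : ℕ}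
    {f : Fin n → A} (hf : G.IsMaximalFrame f) : G.entropy w ≤ shannon fun k => B w (f k) := by
  obtain ⟨m, p, v, hp⟩ := h₁ w hw
  rw [entropy_eq_shannon h₁ h₂ hp]
  exact hB.shannon_le h₁ h₂ hp hf

/-- A term of Gibbs' inequality, in the extended reals. -/
theorem coe_mul_log_ofReal_le {r q : ℝ} (hr : 0 ≤ r) (hq : 0 ≤ q) :
    (r : EReal) * ENNReal.log (ENNReal.ofReal q) ≤ ((q - r - Real.negMulLog r : ℝ) : EReal) := by
  rcases hr.eq_or_lt with rfl | hr
  · simpa using hq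
  rcases hq.eq_or_lt with rfl | hq
  · simp [EReal.coe_mul_bot_of_pos hr]
  · rw [ENNReal.log_ofReal_of_pos hq, ← EReal.coe_mul, EReal.coe_le_coe_iff, Real.negMulLog]
    have h := Real.log_le_sub_one_of_pos (div_pos hq hr)
    rw [Real.log_div hq.ne' hr.ne'] at h
    have h' := mul_le_mul_of_nonneg_left h hr.le
    have h'' : r * (q / r) = q := mul_div_cancel₀ q hr.ne'
    nlinarith

/-- Gibbs' inequality compares `q` with the transition probabilities of `w`, whose Shannon entropy
dominates that of `w`. -/
theorem IsSelfDualizing.relEntropy_nonneg (h₁ : G.ClassicalDecomposability)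
    (h₂ : G.StrongSymmetry) {B : LinearMap.BilinForm ℝ A} (hB : G.IsSelfDualizing B) {w : A}
    (hw : w ∈ G.states) {n : ℕ} {q : Fin n → ℝ} {f : Fin n → A} (hf : G.IsMaximalFrame f)
    (hq : q ∈ stdSimplex ℝ (Fin n)) : 0 ≤ G.relEntropy B w q f := by
  have hcoe : ∀ (s : Finset (Fin n)) (x : Fin n → ℝ),
      ∑ k ∈ s, (x k : EReal) = ((∑ k ∈ s, x k : ℝ) : EReal) := by
    intro s x
    induction s using Finset.induction_on with
    | empty => simp
    | insert a s ha ih => rw [Finset.sum_insert ha, Finset.sum_insert ha, ih, EReal.coe_add]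
  have hle : ∑ k, (B w (f k) : EReal) * ENNReal.log (ENNReal.ofReal (q k)) ≤
      ((-G.entropy w : ℝ) : EReal) := by
    refine (Finset.sum_le_sum fun k _ => coe_mul_log_ofReal_le
      (hB.mem_unitInterval w hw _ (hf.1.mem_states k)).1 (hq.1 k)).trans ?_
    rw [hcoe, EReal.coe_le_coe_iff, Finset.sum_sub_distrib, Finset.sum_sub_distrib, hq.2,
      hB.sum_apply_eq_one h₁ h₂ hf hw]
    have := hB.entropy_le h₁ h₂ hw hf
    rw [shannon] at this
    linarith
  rw [relEntropy, ← EReal.coe_neg]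
  exact (EReal.sub_nonneg (Or.inl (EReal.coe_ne_top _)) (Or.inl (EReal.coe_ne_bot _))).2 hle

theorem entropy_concave (h₁ : G.ClassicalDecomposability) (h₂ : G.StrongSymmetry) {n : ℕ}
    {w : Fin n → A} {p : Fin n → ℝ} (hw : ∀ j, w j ∈ G.states) (hp : p ∈ stdSimplex ℝ (Fin n)) :
    ∑ j, p j * G.entropy (w j) ≤ G.entropy (∑ j, p j • w j) := by
  obtain ⟨B, hB⟩ := exists_isSelfDualizing h₁ h₂
  have hmem : ∑ j, p j • w j ∈ G.states :=
    G.convex_states.sum_mem (fun i _ => hp.1 i) hp.2 fun i _ => hw i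
  obtain ⟨m, q, f, hf, hq⟩ := exists_decomposition_isMaximalFrame h₁ h₂ hmem
  -- In the eigenframe of the mixture, its weights are averages of transition probabilities, so
  -- Jensen applies for each `k`.
  have hqk : ∀ k, q k = ∑ j, p j * B (w j) (f k) := fun k => by
    rw [← hB.orthonormalOnFrames.apply_sum hf.1 q k, ← hq.2.2, hB.symm]
    simp
  rw [entropy_eq_shannon h₁ h₂ hq]
  calc ∑ j, p j * G.entropy (w j)
      ≤ ∑ j, p j * ∑ k, Real.negMulLog (B (w j) (f k)) := Finset.sum_le_sum fun j _ =>
        mul_le_mul_of_nonneg_left (hB.entropy_le h₁ h₂ (hw j) hf) (hp.1 j)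
    _ = ∑ k, ∑ j, p j * Real.negMulLog (B (w j) (f k)) := by
      rw [Finset.sum_comm]
      exact Finset.sum_congr rfl fun j _ => Finset.mul_sum _ _ _
    _ ≤ ∑ k, Real.negMulLog (q k) := Finset.sum_le_sum fun k _ => by
      rw [hqk]
      exact Real.concaveOn_negMulLog.le_map_sum (fun j _ => hp.1 j) hp.2
        fun j _ => (hB.mem_unitInterval _ (hw j) _ (hf.1.mem_states k)).1

end GPT

theorem mainTheorem6 {A : Type*} [NormedAddCommGroup A] [NormedSpace ℝ A] [FiniteDimensional ℝ A]
    (G : GPT A) (h₁ : G.ClassicalDecomposability) (h₂ : G.StrongSymmetry) :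
    -- the entropy is well-defined
    (∀ w ∈ G.states, ∀ (n : ℕ) (p : Fin n → ℝ) (v : Fin n → A),
      G.IsClassicalDecomposition w p v → G.entropy w = GPT.shannon p) ∧
    -- every state has a classical decomposition into a maximal frame
    (∀ v ∈ G.states, ∃ (n : ℕ) (q : Fin n → ℝ) (f : Fin n → A),
      G.IsMaximalFrame f ∧ G.IsClassicalDecomposition v q f) ∧
    -- self-dualizing inner products exist
    (∃ B : LinearMap.BilinForm ℝ A, G.IsSelfDualizing B) ∧
    -- Klein's inequality
    (∀ B : LinearMap.BilinForm ℝ A, G.IsSelfDualizing B →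
      ∀ w ∈ G.states, ∀ v ∈ G.states, ∀ (n : ℕ) (q : Fin n → ℝ) (f : Fin n → A),
        G.IsMaximalFrame f → G.IsClassicalDecomposition v q f → 0 ≤ G.relEntropy B w q f) ∧
    -- concavity of the entropy
    (∀ (n : ℕ) (w : Fin n → A) (p : Fin n → ℝ), (∀ j, w j ∈ G.states) →
      p ∈ stdSimplex ℝ (Fin n) →
        ∑ j, p j * G.entropy (w j) ≤ G.entropy (∑ j, p j • w j)) :=
  ⟨fun _ _ _ _ _ h => GPT.entropy_eq_shannon h₁ h₂ h,
    fun _ hv => GPT.exists_decomposition_isMaximalFrame h₁ h₂ hv,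
    GPT.exists_isSelfDualizing h₁ h₂,
    fun _ hB _ hw _ _ _ _ _ hf hq => hB.relEntropy_nonneg h₁ h₂ hw hf hq.1,
    fun _ _ _ hw hp => GPT.entropy_concave h₁ h₂ hw hp⟩
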